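/- Let $R$ be a commutative ring and let $a,b,c\in R$ be non-zero-divisors. (This covers arbitrary nonzero $a,b,c$ when $R$ is $\mathbb{Z}$, $\mathbb{Q}$, or $\mathbb{Z}_p=\mathbb{Z}/p\mathbb{Z}$ with $p$ prime, and invertible $a,b,c$ in any commutative ring, e.g. $\mathbb{Z}/n\mathbb{Z}$.) Let $H$ be the hypergraph whose vertices are the unordered pairs $\{u,v\}$ of distinct elements of $R$ and whose hyperedges are the sets $\{\{x,y\},\{x,z\},\{y,z\}\}$, where $(x,y,z)$ ranges over the solutions of $ax+by+cz=0$ with $x,y,z\in R$ pairwise distinct. Then: 1. $H$ is $3$-uniform, and every pair $\{u,v\}$ lies in at most $6$ hyperedges of $H$. 2. The unordered pairs of distinct elements of $R$ can be colored with $6$ colors so that for every solution of $ax+by+cz=0$ in pairwise distinct $x,y,z\in R$, the three pairs $\{x,y\},\{x,z\},\{y,z\}$ do not all have the same color. 3. If two of the coefficients $a,b,c$ are equal (for example $a=b$), then every pair lies in at most $3$ hyperedges of $H$, and $3$ colors suffice in 2. -/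

import Mathlib

/-- The three pairs spanned by `x, y, z`: the edge set of the triangle on these vertices. -/
def trianglePairs {R : Type*} (x y z : R) : Set (Sym2 R) :=
  {s(x, y), s(x, z), s(y, z)}

/-- The hypergraph of the equation `a x + b y + c z = 0`. Its vertices are the unordered pairs of
distinct elements of `R`; each solution `(x, y, z)` in pairwise distinct values contributes the
hyperedge consisting of all pairs of its entries. -/
def solutionHypergraph {R : Type*} [CommRing R] (a b c : R) : Hypergraph (Sym2 R) where
  vertexSet := (⊤ : SimpleGraph R).edgeSet
  edgeSet := {e | ∃ x y z : R, x ≠ y ∧ x ≠ z ∧ y ≠ z ∧ a * x + b * y + c * z = 0 ∧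
    e = trianglePairs x y z}
  subset_vertexSet_of_mem_edgeSet' := by
    rintro e ⟨x, y, z, hxy, hxz, hyz, -, rfl⟩ p hp
    rcases hp with rfl | rfl | rfl <;> simpa

/-- A coloring `χ` of the pairs of distinct elements of `R` such that no solution of
`a x + b y + c z = 0` in pairwise distinct values induces a monochromatic triangle. -/
def AvoidsMonochromaticSolutions {R K : Type*} [CommRing R] (a b c : R)
    (χ : SimpleGraph.TopEdgeLabeling R K) : Prop :=
  ∀ (x y z : R) (hxy : x ≠ y) (hxz : x ≠ z) (hyz : y ≠ z), a * x + b * y + c * z = 0 →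
    ¬ (χ.get x y hxy = χ.get x z hxz ∧ χ.get x z hxz = χ.get y z hyz)

/-!
The hyperedges containing a fixed pair `{u, v}` are determined by the third entry `w` of the
solution: placing `u`, `v`, `w` in the three positions gives six linear equations in `w`, each with
at most one root because its leading coefficient is not a zero divisor. This bounds the degree by
`6`; if two coefficients agree, the six equations coincide in pairs and the bound drops to `3`.

The colorings come from a general fact (`exists_coloring_of_encard_eq_three`): a `3`-uniform
hypergraph with all degrees at most `Δ`, where `3 ≤ Δ`, has a `Δ`-coloring without monochromatic
hyperedges. A greedy coloring would need `Δ + 1` colors; one color is saved with Hall's theorem.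
A set `S` of vertices of degree at least `3` meets at least `|S|` hyperedges, since each hyperedge
has only `3` vertices, so distinct hyperedges can be assigned to the vertices of degree `Δ`
(`exists_injective_mem_of_three_le_encard`). Delete from every hyperedge the vertex it is assigned
to, or an arbitrary one if there is none. The remaining pairs form a graph in which every vertex has
fewer than `Δ` neighbors, and a greedy coloring of that graph along a well-order uses `Δ` colors
(`SimpleGraph.exists_coloring_of_encard_lt`). No finiteness of the ring is needed, as both Hall's theorem for
finite neighborhoods and the greedy coloring work over arbitrary vertex sets.
-/

/-! ### Colorings of 3-uniform hypergraphs -/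

/-- Greedy coloring along a well-order: a graph, possibly infinite, in which every vertex has fewer
than `n` neighbors is `n`-colorable. -/
theorem SimpleGraph.exists_coloring_of_encard_lt {V : Type*} (G : SimpleGraph V) (n : ℕ)
    (h : ∀ v, (G.neighborSet v).encard < n) : Nonempty (G.Coloring (Fin n)) := by
  have wf : WellFounded (WellOrderingRel (α := V)) := WellOrderingRel.isWellOrder.wf
  have free (v : V) (c : V → Fin n) : ∃ k : Fin n, k ∉ c '' G.neighborSet v := by
    by_contra! hall
    have hle := Set.encard_image_le c (G.neighborSet v)
    rw [Set.eq_univ_of_forall hall, Set.encard_univ, ENat.card_eq_coe_fintype_card,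
      Fintype.card_fin] at hle
    exact absurd (h v) hle.not_gt
  have step (v : V) (c : (w : V) → WellOrderingRel w v → Fin n) :
      ∃ k : Fin n, ∀ w (hw : WellOrderingRel w v), G.Adj v w → c w hw ≠ k := by
    classical
    have hn : 0 < n := by exact_mod_cast zero_le.trans_lt (h v)
    obtain ⟨k, hk⟩ := free v (fun w => if hw : WellOrderingRel w v then c w hw else ⟨0, hn⟩)
    refine ⟨k, fun w hw hadj heq => hk ⟨w, hadj, ?_⟩⟩
    simp [hw, heq]
  choose F hF using step
  have key (v w : V) (hw : WellOrderingRel w v) (hadj : G.Adj v w) : wf.fix F w ≠ wf.fix F v := by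
    rw [wf.fix_eq F v]
    exact hF v (fun w _ => wf.fix F w) w hw hadj
  refine ⟨SimpleGraph.Coloring.mk (wf.fix F) fun {v w} hadj => ?_⟩
  rcases trichotomous_of WellOrderingRel v w with hlt | rfl | hlt
  · exact key w v hlt hadj.symm
  · exact absurd rfl hadj.ne
  · exact (key v w hlt hadj).symm

/-- If every hyperedge has three elements, the vertices whose degree is finite and at least three
can be assigned distinct hyperedges containing them. -/
theorem exists_injective_mem_of_three_le_encard {V : Type*} (E : Set (Set V))
    (hE : ∀ e ∈ E, e.encard = 3) (S : Set V) (hfin : ∀ v ∈ S, {e ∈ E | v ∈ e}.Finite)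
    (hS : ∀ v ∈ S, 3 ≤ {e ∈ E | v ∈ e}.encard) :
    ∃ f : S → Set V, Function.Injective f ∧ ∀ v, f v ∈ E ∧ v.1 ∈ f v := by
  classical
  let t (v : S) : Finset (Set V) := (hfin v v.2).toFinset
  have ht (v : S) (e : Set V) : e ∈ t v ↔ e ∈ E ∧ v.1 ∈ e := by simp [t]
  obtain ⟨f, hf, hft⟩ := (Finset.all_card_le_biUnion_card_iff_exists_injective t).mp fun s => by
    -- Double counting of incidences: at least `3` at each vertex, at most `3` in each hyperedge.
    refine Nat.le_of_mul_le_mul_right (c := 3) (Finset.card_mul_le_card_mul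
      (fun (v : S) (e : Set V) => e ∈ t v) (fun v hv => ?_) (fun e he => ?_)) (by norm_num)
    · have heq : (s.biUnion t).bipartiteAbove (fun (v : S) (e : Set V) => e ∈ t v) v = t v := by
        ext e
        simp only [Finset.mem_bipartiteAbove, Finset.mem_biUnion]
        exact ⟨fun h => h.2, fun h => ⟨⟨v, hv, h⟩, h⟩⟩
      rw [heq]
      have := hS v v.2
      rw [(hfin v v.2).encard_eq_coe_toFinset_card] at this
      exact_mod_cast this
    · obtain ⟨v, -, hv⟩ := Finset.mem_biUnion.mp he
      have hle : (((s.bipartiteBelow (fun (v : S) (e : Set V) => e ∈ t v) e : Finset S) :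
          Set S)).encard ≤ e.encard := by
        refine Set.encard_le_encard_of_injOn (f := Subtype.val) (fun w hw => ?_)
          Subtype.val_injective.injOn
        exact ((ht w e).mp (Finset.mem_bipartiteBelow _ |>.mp (Finset.mem_coe.mp hw)).2).2
      rw [hE e ((ht v e).mp hv).1, Set.encard_coe_eq_coe_finsetCard] at hle
      exact_mod_cast hle
  exact ⟨f, hf, fun v => (ht v _).mp (hft v)⟩

/-- A `3`-uniform hypergraph with maximum degree at most `Δ`, where `3 ≤ Δ`, has a `Δ`-coloring of
its vertices without monochromatic hyperedges. -/
theorem exists_coloring_of_encard_eq_three {V : Type*} (E : Set (Set V)) (Δ : ℕ) (hΔ : 3 ≤ Δ)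
    (hE : ∀ e ∈ E, e.encard = 3) (hdeg : ∀ v, {e ∈ E | v ∈ e}.encard ≤ Δ) :
    ∃ χ : V → Fin Δ, ∀ e ∈ E, ∃ u ∈ e, ∃ v ∈ e, χ u ≠ χ v := by
  obtain ⟨f, hf, hfE⟩ := exists_injective_mem_of_three_le_encard E hE
    {v | {e ∈ E | v ∈ e}.encard = Δ}
    (fun v _ => Set.finite_of_encard_le_coe (hdeg v))
    (fun v hv => by rw [show _ = _ from hv]; exact_mod_cast hΔ)
  -- `d e` is the vertex deleted from the hyperedge `e`.
  have hd : ∀ e ∈ E, ∃ d ∈ e, ∀ v, f v = e → d = v.1 := fun e he => by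
    by_cases h : ∃ v, f v = e
    · obtain ⟨v, rfl⟩ := h
      exact ⟨v, (hfE v).2, fun w hw => by rw [hf hw]⟩
    · push Not at h
      obtain ⟨x, hx⟩ := Set.nonempty_of_encard_ne_zero (s := e) (by simp [hE e he])
      exact ⟨x, hx, fun v hv => absurd hv (h v)⟩
  choose d hdmem hdf using hd
  -- The pairs left in the hyperedges after the deletions are the edges of `G`.
  let G : SimpleGraph V :=
    { Adj u v := u ≠ v ∧ ∃ (e : Set V) (he : e ∈ E), u ∈ e ∧ v ∈ e ∧ u ≠ d e he ∧ v ≠ d e he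
      symm := ⟨fun u v ⟨hne, e, he, hu, hv, hud, hvd⟩ => ⟨hne.symm, e, he, hv, hu, hvd, hud⟩⟩
      loopless := ⟨fun _ h => h.1 rfl⟩ }
  have hG : ∀ v, (G.neighborSet v).encard < Δ := fun v => by
    -- The hyperedges that keep `v`; each contributes one neighbor.
    let K : Set (Set V) := {e | ∃ he : e ∈ E, v ∈ e ∧ v ≠ d e he}
    have hKsub : K ⊆ {e ∈ E | v ∈ e} := fun e ⟨he, hv, _⟩ => ⟨he, hv⟩
    have hK : K.encard < Δ := by
      rcases (hdeg v).lt_or_eq with hlt | heq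
      · exact (Set.encard_le_encard hKsub).trans_lt hlt
      · rw [← heq]
        -- A vertex of degree `Δ` is deleted from the hyperedge assigned to it.
        refine (Set.finite_of_encard_le_coe (hdeg v)).subset hKsub |>.encard_lt_encard
          (hKsub.ssubset_of_mem_notMem (hfE ⟨v, heq⟩) ?_)
        rintro ⟨he, -, hne⟩
        exact hne (hdf _ he ⟨v, heq⟩ rfl).symm
    refine lt_of_le_of_lt ?_ hK
    have hex : ∀ u : V, ∃ e : Set V, G.Adj v u →
        ∃ he : e ∈ E, v ∈ e ∧ u ∈ e ∧ v ≠ d e he ∧ u ≠ d e he := fun u => by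
      by_cases h : G.Adj v u
      · obtain ⟨-, e, he, h⟩ := h
        exact ⟨e, fun _ => ⟨he, h⟩⟩
      · exact ⟨∅, fun h' => absurd h' h⟩
    choose g hg using hex
    refine Set.encard_le_encard_of_injOn (f := g) (fun u hu => ?_) (fun u hu u' hu' heq => ?_)
    · obtain ⟨he, hv, -, hvd, -⟩ := hg u hu
      exact ⟨he, hv, hvd⟩
    · obtain ⟨he, hv, hue, hvd, hud⟩ := hg u hu
      obtain ⟨he', -, hue', -, hud'⟩ := hg u' hu'
      have hne : v ≠ u := hu.1
      have hne' : v ≠ u' := hu'.1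
      have hde := hdmem _ he
      simp only [← heq] at hue' hud'
      obtain ⟨x, y, z, -, -, -, hxyz⟩ := Set.encard_eq_three.mp (hE _ he)
      generalize d (g u) he = p at *
      rw [hxyz] at hv hue hue' hde
      simp only [Set.mem_insert_iff, Set.mem_singleton_iff] at hv hue hue' hde
      grind
  obtain ⟨χ⟩ := G.exists_coloring_of_encard_lt Δ hG
  refine ⟨χ, fun e he => ?_⟩
  have hpair : 1 < (e \ {d e he}).encard := by
    have h := Set.encard_sdiff_singleton_add_one (hdmem e he)
    rw [hE e he] at h
    by_contra! hle
    have : (3 : ℕ∞) ≤ 1 + 1 := h ▸ add_le_add_left hle 1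
    exact absurd this (by norm_num)
  obtain ⟨u, v, ⟨hu, hud⟩, ⟨hv, hvd⟩, hne⟩ := Set.one_lt_encard_iff.mp hpair
  exact ⟨u, hu, v, hv, χ.valid ⟨hne, e, he, hu, hv, hud, hvd⟩⟩

/-! ### The hypergraph of a linear equation -/

theorem encard_trianglePairs {R : Type*} {x y z : R} (hxy : x ≠ y) (hxz : x ≠ z) (hyz : y ≠ z) :
    (trianglePairs x y z).encard = 3 := by
  refine Set.encard_eq_three.mpr ⟨s(x, y), s(x, z), s(y, z), ?_, ?_, ?_, rfl⟩ <;>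
    simp only [ne_eq, Sym2.eq_iff] <;> grind

theorem trianglePairs_swap {R : Type*} (x y z : R) :
    trianglePairs x y z = trianglePairs y x z := by
  ext p
  simp only [trianglePairs, Set.mem_insert_iff, Set.mem_singleton_iff,
    Sym2.eq_swap (a := x) (b := y)]
  tauto

theorem trianglePairs_rotate {R : Type*} (x y z : R) :
    trianglePairs x y z = trianglePairs y z x := by
  ext p
  simp only [trianglePairs, Set.mem_insert_iff, Set.mem_singleton_iff,
    Sym2.eq_swap (a := x) (b := y),
    Sym2.eq_swap (a := x) (b := z)]
  tauto

section Equation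

variable {R : Type*} [CommRing R]

/-- The values that complete `x` and `y` to a solution when the third variable has the
coefficient `c`. -/
def completions (a b c x y : R) : Set R :=
  {w | a * x + b * y + c * w = 0}

theorem encard_completions_le_one {c : R} (hc : c ∈ nonZeroDivisors R) (a b x y : R) :
    (completions a b c x y).encard ≤ 1 := by
  refine Set.encard_le_one_iff.mpr fun w w' hw hw' => ?_
  exact (mul_cancel_left_mem_nonZeroDivisors hc).mp (add_left_cancel (hw.trans hw'.symm))

/-- Both orders in which `u` and `v` can occupy the two positions other than that of the
coefficient `c`. -/
def pairCompletions (a b c u v : R) : Set R :=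
  completions a b c u v ∪ completions a b c v u

theorem encard_pairCompletions_le_two {c : R} (hc : c ∈ nonZeroDivisors R) (a b u v : R) :
    (pairCompletions a b c u v).encard ≤ 2 := by
  grw [pairCompletions, Set.encard_union_le, encard_completions_le_one hc,
    encard_completions_le_one hc]
  norm_num

theorem encard_pairCompletions_self_le_one {c : R} (hc : c ∈ nonZeroDivisors R) (a u v : R) :
    (pairCompletions a a c u v).encard ≤ 1 := by
  have h : completions a a c v u = completions a a c u v := by
    simp only [completions, add_comm (a * v)]
  rw [pairCompletions, h, Set.union_self]
  exact encard_completions_le_one hc a a u v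

theorem pairCompletions_comm (a b c u v : R) :
    pairCompletions a b c u v = pairCompletions b a c u v := by
  simp only [pairCompletions, completions, add_comm (a * _)]
  exact Set.union_comm _ _

/-- A hyperedge through `{u, v}` is the triangle on `u`, `v` and a third entry, which solves the
equation in one of the three positions. -/
theorem setOf_mem_edgeSet_subset (a b c u v : R) :
    {e ∈ (solutionHypergraph a b c).edgeSet | s(u, v) ∈ e} ⊆
      trianglePairs u v '' (pairCompletions a b c u v ∪ pairCompletions a c b u v ∪
        pairCompletions b c a u v) := by
  rintro e ⟨⟨x, y, z, -, -, -, h, rfl⟩, huv⟩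
  rcases huv with huv | huv | huv
  · refine ⟨z, .inl (.inl ?_), ?_⟩ <;> rcases Sym2.eq_iff.mp huv with ⟨rfl, rfl⟩ | ⟨rfl, rfl⟩
    · exact .inl h
    · exact .inr h
    · rfl
    · exact trianglePairs_swap _ _ _
  · have h' : a * x + c * z + b * y = 0 := by rw [← h]; ring
    refine ⟨y, .inl (.inr ?_), ?_⟩ <;> rcases Sym2.eq_iff.mp huv with ⟨rfl, rfl⟩ | ⟨rfl, rfl⟩
    · exact .inl h'
    · exact .inr h'
    · rw [trianglePairs_swap, trianglePairs_rotate]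
    · rw [trianglePairs_rotate]
  · have h' : b * y + c * z + a * x = 0 := by rw [← h]; ring
    refine ⟨x, .inr ?_, ?_⟩ <;> rcases Sym2.eq_iff.mp huv with ⟨rfl, rfl⟩ | ⟨rfl, rfl⟩
    · exact .inl h'
    · exact .inr h'
    · rw [← trianglePairs_rotate]
    · rw [trianglePairs_swap, ← trianglePairs_rotate]

theorem encard_setOf_mem_edgeSet_le (a b c u v : R) :
    {e ∈ (solutionHypergraph a b c).edgeSet | s(u, v) ∈ e}.encard ≤
      (pairCompletions a b c u v ∪ pairCompletions a c b u v ∪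
        pairCompletions b c a u v).encard :=
  (Set.encard_le_encard (setOf_mem_edgeSet_subset a b c u v)).trans (Set.encard_image_le _ _)

theorem encard_setOf_mem_edgeSet_le_six {a b c : R} (ha : a ∈ nonZeroDivisors R)
    (hb : b ∈ nonZeroDivisors R) (hc : c ∈ nonZeroDivisors R) (p : Sym2 R) :
    {e ∈ (solutionHypergraph a b c).edgeSet | p ∈ e}.encard ≤ 6 := by
  induction p with | _ u v
  grw [encard_setOf_mem_edgeSet_le, Set.encard_union_le, Set.encard_union_le,
    encard_pairCompletions_le_two ha, encard_pairCompletions_le_two hb,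
    encard_pairCompletions_le_two hc]
  norm_num

/-- If two coefficients agree, exchanging the values at their positions gives a solution again, so
two of the three sets of third entries coincide and the remaining one has at most one element. -/
theorem encard_setOf_mem_edgeSet_le_three {a b c : R} (ha : a ∈ nonZeroDivisors R)
    (hb : b ∈ nonZeroDivisors R) (hc : c ∈ nonZeroDivisors R) (h : a = b ∨ a = c ∨ b = c)
    (p : Sym2 R) : {e ∈ (solutionHypergraph a b c).edgeSet | p ∈ e}.encard ≤ 3 := by
  induction p with | _ u v
  grw [encard_setOf_mem_edgeSet_le]
  rcases h with rfl | rfl | rfl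
  · grw [Set.union_assoc, Set.union_self, Set.encard_union_le,
      encard_pairCompletions_self_le_one hc, encard_pairCompletions_le_two ha]
    norm_num
  · grw [pairCompletions_comm b a a, Set.union_right_comm, Set.union_self, Set.encard_union_le,
      encard_pairCompletions_self_le_one hb, encard_pairCompletions_le_two ha]
    norm_num
  · grw [Set.union_self, Set.encard_union_le,
      encard_pairCompletions_self_le_one ha, encard_pairCompletions_le_two hb]
    norm_num

theorem encard_eq_three_of_mem_edgeSet {a b c : R} {e : Set (Sym2 R)}
    (he : e ∈ (solutionHypergraph a b c).edgeSet) : e.encard = 3 := by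
  obtain ⟨x, y, z, hxy, hxz, hyz, -, rfl⟩ := he
  exact encard_trianglePairs hxy hxz hyz

theorem exists_avoidsMonochromaticSolutions (a b c : R) (Δ : ℕ) (hΔ : 3 ≤ Δ)
    (hdeg : ∀ p, {e ∈ (solutionHypergraph a b c).edgeSet | p ∈ e}.encard ≤ Δ) :
    ∃ χ : SimpleGraph.TopEdgeLabeling R (Fin Δ), AvoidsMonochromaticSolutions a b c χ := by
  obtain ⟨χ, hχ⟩ := exists_coloring_of_encard_eq_three (solutionHypergraph a b c).edgeSet Δ hΔ
    (fun e he => encard_eq_three_of_mem_edgeSet he) hdeg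
  refine ⟨fun p => χ p.1, fun x y z hxy hxz hyz h ⟨h₁, h₂⟩ => ?_⟩
  obtain ⟨p, hp, q, hq, hne⟩ := hχ _ ⟨x, y, z, hxy, hxz, hyz, h, rfl⟩
  change χ s(x, y) = χ s(x, z) at h₁
  change χ s(x, z) = χ s(y, z) at h₂
  rcases hp with rfl | rfl | rfl <;> rcases hq with rfl | rfl | rfl <;> simp_all

end Equation

theorem mainTheorem8 {R : Type*} [CommRing R] (a b c : R)
    (ha : a ∈ nonZeroDivisors R) (hb : b ∈ nonZeroDivisors R) (hc : c ∈ nonZeroDivisors R) :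
    (∀ e ∈ (solutionHypergraph a b c).edgeSet, e.encard = 3) ∧
    (∀ p ∈ (solutionHypergraph a b c).vertexSet,
      {e ∈ (solutionHypergraph a b c).edgeSet | p ∈ e}.encard ≤ 6) ∧
    (∃ χ : SimpleGraph.TopEdgeLabeling R (Fin 6), AvoidsMonochromaticSolutions a b c χ) ∧
    (a = b ∨ a = c ∨ b = c →
      (∀ p ∈ (solutionHypergraph a b c).vertexSet,
        {e ∈ (solutionHypergraph a b c).edgeSet | p ∈ e}.encard ≤ 3) ∧
      ∃ χ : SimpleGraph.TopEdgeLabeling R (Fin 3), AvoidsMonochromaticSolutions a b c χ) := by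
  have h6 := encard_setOf_mem_edgeSet_le_six ha hb hc
  refine ⟨fun e he => encard_eq_three_of_mem_edgeSet he, fun p _ => h6 p,
    exists_avoidsMonochromaticSolutions a b c 6 (by norm_num) h6, fun h => ?_⟩
  have h3 := encard_setOf_mem_edgeSet_le_three ha hb hc h
  exact ⟨fun p _ => h3 p, exists_avoidsMonochromaticSolutions a b c 3 le_rfl h3⟩
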